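/- Let $m,n$ be natural numbers and let $\theta$ be a permutation of $\{1,\dots,m\}\times\{1,\dots,n\}$. Let $\mathbb{F}_\theta^+$ be the unital semigroup with generators $e_1,\dots,e_m,f_1,\dots,f_n$ and relations $e_if_j=f_{j'}e_{i'}$ whenever $\theta(i,j)=(i',j')$. The degree $d(w)=(k,l)$ of a word $w$ counts its $e$'s and its $f$'s. An infinite word $\tau=e_{i_0}f_{j_0}e_{i_1}f_{j_1}\cdots$ has initial segments $\tau_T=e_{i_0}f_{j_0}\cdots e_{i_{T-1}}f_{j_{T-1}}$. For integers $s,t\le 0$, the labels $i_{s,t}$ and $j_{s,t}$ of $\tau$ are defined as follows: for large $T$, factor $\tau_T=w_1w_2$ with $d(w_1)=(|s|,|t|)$; then $w_2$ can be written as a word beginning with $e_{i_{s,t}}$ and also as a word beginning with $f_{j_{s,t}}$. The symmetry group $H_\tau$ is the set of $(p,q)\in\mathbb{Z}^2$ for which there is an integer $T$ such that $(i_{s+p,t+q},j_{s+p,t+q})=(i_{s,t},j_{s,t})$ for all $s,t\le T$ with $s,\,t,\,s+p,\,t+q\le 0$. The semigroup $\mathbb{F}_\theta^+$ is called aperiodic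 if $H_\tau=\{(0,0)\}$ for some infinite word $\tau$. A $*$-representation $\sigma$ of $\mathbb{F}_\theta^+$ is a representation by bounded operators on a Hilbert space such that $\sigma(e_i)^*\sigma(e_{i'})=\delta_{i,i'}I$, $\sigma(f_j)^*\sigma(f_{j'})=\delta_{j,j'}I$ and $\sum_i\sigma(e_i)\sigma(e_i)^*=I=\sum_j\sigma(f_j)\sigma(f_j)^*$. Let $\mathrm{C}^*(\mathbb{F}_\theta^+)$ be the universal C*-algebra for the $*$-representations of $\mathbb{F}_\theta^+$; words are identified with their images in it. For $\alpha,\beta\in\mathbb{T}$ let $\gamma_{\alpha,\beta}$ be the gauge automorphism with $\gamma_{\alpha,\beta}(e_i)=\alpha e_i$ and $\gamma_{\alpha,\beta}(f_j)=\beta f_j$, and let \[ \Phi(X)=\int_{\mathbb{T}^2}\gamma_{\alpha,\beta}(X)\,d\alpha\,d\beta \] with respect to normalised Lebesgue measure. Let $\mathfrak{F}_k=\operatorname{span}\{xy^*: d(x)=d(y)=(k,k)\}$, and let $\mathfrak{F}=\overline{\bigcup_{k\ge1}\mathfrak{F}_k}$ be the UHF core. Theorem. Suppose that $\mathbb{F}_\theta^+$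 is aperiodic. Then the range of $\Phi$ is $\mathfrak{F}$ and $\Phi(A)=A$ for all $A\in\mathfrak{F}$. Moreover, there are words $\tau_k\in\mathbb{F}_\theta^+$ ($k\ge0$) such that the elements \[ W_k=\sum_{d(x)=(k,k)}x\,\tau_k\,x^* \] of $\mathrm{C}^*(\mathbb{F}_\theta^+)$ are isometries ($W_k^*W_k=I$) and \[ \Phi(A)=\lim_{k\to\infty}W_k^*AW_k\quad\text{in norm, for all } A\in\mathrm{C}^*(\mathbb{F}_\theta^+). \] -/

import Mathlib

open scoped ENNReal

/-- The defining relations `e_i f_j = f_{j'} e_{i'}`, where `θ (i, j) = (i', j')`; the generator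
`e_i` is `Sum.inl i` and the generator `f_j` is `Sum.inr j`. -/
inductive TwoGraph.Rel {m n : ℕ} (θ : Equiv.Perm (Fin m × Fin n)) :
    FreeMonoid (Fin m ⊕ Fin n) → FreeMonoid (Fin m ⊕ Fin n) → Prop
  | comm (i : Fin m) (j : Fin n) :
      TwoGraph.Rel θ (FreeMonoid.of (Sum.inl i) * FreeMonoid.of (Sum.inr j))
        (FreeMonoid.of (Sum.inr (θ (i, j)).2) * FreeMonoid.of (Sum.inl (θ (i, j)).1))

/-- The semigroup `𝔽_θ⁺` of the single vertex 2-graph given by `θ`. -/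
abbrev TwoGraph {m n : ℕ} (θ : Equiv.Perm (Fin m × Fin n)) : Type :=
  PresentedMonoid (TwoGraph.Rel θ)

namespace TwoGraph

variable {m n : ℕ} {θ : Equiv.Perm (Fin m × Fin n)}

/-- The generator `e_i`. -/
def e (θ : Equiv.Perm (Fin m × Fin n)) (i : Fin m) : TwoGraph θ :=
  PresentedMonoid.of (Rel θ) (Sum.inl i)

/-- The generator `f_j`. -/
def f (θ : Equiv.Perm (Fin m × Fin n)) (j : Fin n) : TwoGraph θ :=
  PresentedMonoid.of (Rel θ) (Sum.inr j)

/-- The homomorphism from `𝔽_θ⁺` to a commutative monoid with `e_i ↦ a` and `f_j ↦ b`. -/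
def countHom {M : Type*} [CommMonoid M] (θ : Equiv.Perm (Fin m × Fin n)) (a b : M) :
    TwoGraph θ →* M :=
  PresentedMonoid.lift (Sum.elim (fun _ => a) (fun _ => b)) (by
    rintro _ _ ⟨i, j⟩
    simp [mul_comm])

/-- The degree `d(w) = (k, l)`: the number of `e`'s and the number of `f`'s in `w`. -/
def degree (w : TwoGraph θ) : ℕ × ℕ :=
  (countHom θ (Multiplicative.ofAdd ((1, 0) : ℕ × ℕ)) (Multiplicative.ofAdd (0, 1)) w).toAdd

theorem induction_word {p : TwoGraph θ → Prop} (h1 : p 1)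
    (he : ∀ i w, p w → p (e θ i * w)) (hf : ∀ j w, p w → p (f θ j * w)) (w : TwoGraph θ) : p w := by
  obtain ⟨a, rfl⟩ := PresentedMonoid.surjective_mk w
  induction a using FreeMonoid.inductionOn' with
  | one => exact h1
  | of_mul x xs ih =>
    rw [map_mul]
    cases x with
    | inl i => exact he i _ ih
    | inr j => exact hf j _ ih

@[simp] theorem degree_one : degree (1 : TwoGraph θ) = 0 := by simp [degree]

@[simp] theorem degree_mul (v w : TwoGraph θ) : degree (v * w) = degree v + degree w := by
  simp [degree]

@[simp] theorem degree_e (i : Fin m) : degree (e θ i) = (1, 0) := rfl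

@[simp] theorem degree_f (j : Fin n) : degree (f θ j) = (0, 1) := rfl

/-- There are only finitely many words of a given degree. -/
theorem finite_degree (d : ℕ × ℕ) : {w : TwoGraph θ | degree w = d}.Finite := by
  have hlen : ∀ l : List (Fin m ⊕ Fin n),
      (degree (PresentedMonoid.mk (Rel θ) (FreeMonoid.ofList l))).1 +
        (degree (PresentedMonoid.mk (Rel θ) (FreeMonoid.ofList l))).2 = l.length := by
    intro l
    induction l with
    | nil => simp
    | cons x xs ih =>
      rw [FreeMonoid.ofList_cons, map_mul, degree_mul]
      have hx : (degree (PresentedMonoid.mk (Rel θ) (FreeMonoid.of x))).1 +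
          (degree (PresentedMonoid.mk (Rel θ) (FreeMonoid.of x))).2 = 1 := by
        cases x <;> rfl
      simp only [Prod.fst_add, Prod.snd_add, List.length_cons]
      omega
  refine ((List.finite_length_eq (Fin m ⊕ Fin n) (d.1 + d.2)).image
    (fun l => PresentedMonoid.mk (Rel θ) (FreeMonoid.ofList l))).subset ?_
  intro w hw
  obtain ⟨a, rfl⟩ := PresentedMonoid.surjective_mk w
  refine ⟨FreeMonoid.toList a, ?_, by simp⟩
  have := hlen (FreeMonoid.toList a)
  have hw' : degree (PresentedMonoid.mk (Rel θ) a) = d := hw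
  rw [FreeMonoid.ofList_toList, hw'] at this
  exact this.symm

/-- The finite set `S_k` of words of degree `(k, k)`. -/
noncomputable def wordsOfDegree (θ : Equiv.Perm (Fin m × Fin n)) (k : ℕ) : Finset (TwoGraph θ) :=
  (finite_degree (θ := θ) (k, k)).toFinset

/-! ### Tails and aperiodicity -/

/-- An infinite word `τ = e_{i_0} f_{j_0} e_{i_1} f_{j_1} ⋯` in standard form, given by its
letters. -/
structure Tail (m n : ℕ) where
  i : ℕ → Fin m
  j : ℕ → Fin n

/-- The finite segment `τ_T = e_{i_0} f_{j_0} ⋯ e_{i_{T-1}} f_{j_{T-1}}`. -/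
def Tail.initial (θ : Equiv.Perm (Fin m × Fin n)) (τ : Tail m n) : ℕ → TwoGraph θ
  | 0 => 1
  | T + 1 => τ.initial θ T * (e θ (τ.i T) * f θ (τ.j T))

/-- `i = i_{s,t}` for `s, t ≤ 0`: the blue edge leading into the vertex `ξ_{s,t}` of the
representation determined by `τ` is labelled `e_i`. That is, when a long initial segment of `τ`
is factored as `w₁ w₂` with `d(w₁) = (|s|, |t|)`, the word `w₂` begins with `e_i`. -/
def Tail.BlueLabel (θ : Equiv.Perm (Fin m × Fin n)) (τ : Tail m n) (s t : ℤ) (i : Fin m) : Prop :=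
  ∃ (T : ℕ) (w₁ w : TwoGraph θ),
    degree w₁ = (s.natAbs, t.natAbs) ∧ τ.initial θ T = w₁ * (e θ i * w)

/-- `j = j_{s,t}` for `s, t ≤ 0`: the red edge leading into the vertex `ξ_{s,t}` of the
representation determined by `τ` is labelled `f_j`. -/
def Tail.RedLabel (θ : Equiv.Perm (Fin m × Fin n)) (τ : Tail m n) (s t : ℤ) (j : Fin n) : Prop :=
  ∃ (T : ℕ) (w₁ w : TwoGraph θ),
    degree w₁ = (s.natAbs, t.natAbs) ∧ τ.initial θ T = w₁ * (f θ j * w)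

/-- `τ₁` and `τ₂` are `(p, q)`-shift tail equivalent: there is an integer `T` with
`(i¹_{s+p,t+q}, j¹_{s+p,t+q}) = (i²_{s,t}, j²_{s,t})` for all `s, t ≤ T` (where the data are
defined, i.e. where all four indices are nonpositive). -/
def ShiftTailEquiv (θ : Equiv.Perm (Fin m × Fin n)) (τ₁ τ₂ : Tail m n) (p q : ℤ) : Prop :=
  ∃ T : ℤ, ∀ s t : ℤ, s ≤ T → t ≤ T → s ≤ 0 → t ≤ 0 → s + p ≤ 0 → t + q ≤ 0 →
    (∀ i, τ₁.BlueLabel θ (s + p) (t + q) i ↔ τ₂.BlueLabel θ s t i) ∧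
    (∀ j, τ₁.RedLabel θ (s + p) (t + q) j ↔ τ₂.RedLabel θ s t j)

/-- The symmetry group `H_τ ⊆ ℤ²` of a tail. -/
def symmetryGroup (θ : Equiv.Perm (Fin m × Fin n)) (τ : Tail m n) : Set (ℤ × ℤ) :=
  {h | ShiftTailEquiv θ τ τ h.1 h.2}

/-- `𝔽_θ⁺` is aperiodic: there is an infinite word with trivial symmetry group. -/
def IsAperiodic (θ : Equiv.Perm (Fin m × Fin n)) : Prop :=
  ∃ τ : Tail m n, symmetryGroup θ τ = {(0, 0)}

/-! ### The universal C*-algebra -/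

/-- A `*`-representation of `𝔽_θ⁺` (row isometric and defect free) on a nonzero Hilbert space. -/
structure StarRep (θ : Equiv.Perm (Fin m × Fin n)) : Type 1 where
  H : Type
  [normedAddCommGroup : NormedAddCommGroup H]
  [innerProductSpace : InnerProductSpace ℂ H]
  [completeSpace : CompleteSpace H]
  [nontrivial : Nontrivial H]
  /-- the operators `σ(w)` -/
  hom : TwoGraph θ →* (H →L[ℂ] H)
  isometric_e : ∀ i i', star (hom (e θ i)) * hom (e θ i') = if i = i' then 1 else 0
  isometric_f : ∀ j j', star (hom (f θ j)) * hom (f θ j') = if j = j' then 1 else 0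
  defectFree_e : ∑ i, hom (e θ i) * star (hom (e θ i)) = 1
  defectFree_f : ∑ j, hom (f θ j) * star (hom (f θ j)) = 1

attribute [instance] StarRep.normedAddCommGroup StarRep.innerProductSpace StarRep.completeSpace
  StarRep.nontrivial

namespace StarRep

theorem star_hom_mul_hom (σ : StarRep θ) (w : TwoGraph θ) : star (σ.hom w) * σ.hom w = 1 := by
  induction w using induction_word with
  | h1 => simp
  | he i w ih =>
    rw [map_mul, star_mul, mul_assoc, ← mul_assoc (star (σ.hom (e θ i))), σ.isometric_e, if_pos rfl,
      one_mul, ih]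
  | hf j w ih =>
    rw [map_mul, star_mul, mul_assoc, ← mul_assoc (star (σ.hom (f θ j))), σ.isometric_f, if_pos rfl,
      one_mul, ih]

theorem norm_hom (σ : StarRep θ) (w : TwoGraph θ) : ‖σ.hom w‖ = 1 := by
  have h := CStarRing.norm_star_mul_self (x := σ.hom w)
  rw [star_hom_mul_hom, norm_one] at h
  nlinarith [norm_nonneg (σ.hom w)]

theorem star_smul_mul_smul {A : Type*} [CStarAlgebra A] (c : Circle) (x y : A) :
    star ((c : ℂ) • x) * ((c : ℂ) • y) = star x * y := by
  rw [star_smul, smul_mul_smul_comm, Complex.star_def, ← Circle.coe_inv_eq_conj, ← Circle.coe_mul,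
    inv_mul_cancel, Circle.coe_one, one_smul]

theorem smul_mul_star_smul {A : Type*} [CStarAlgebra A] (c : Circle) (x y : A) :
    ((c : ℂ) • x) * star ((c : ℂ) • y) = x * star y := by
  rw [star_smul, smul_mul_smul_comm, Complex.star_def, ← Circle.coe_inv_eq_conj, ← Circle.coe_mul,
    mul_inv_cancel, Circle.coe_one, one_smul]

/-- The `*`-representation `e_i ↦ α σ(e_i)`, `f_j ↦ β σ(f_j)`, on the same Hilbert space. -/
noncomputable def twist (σ : StarRep θ) (α β : Circle) : StarRep θ where
  H := σ.H
  hom :=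
    { toFun := fun w => ((countHom θ α β w : Circle) : ℂ) • σ.hom w
      map_one' := by simp
      map_mul' := fun v w => by
        rw [map_mul, map_mul, smul_mul_smul_comm, Circle.coe_mul] }
  isometric_e := fun i i' => (star_smul_mul_smul α _ _).trans (σ.isometric_e i i')
  isometric_f := fun j j' => (star_smul_mul_smul β _ _).trans (σ.isometric_f j j')
  defectFree_e := (Finset.sum_congr rfl fun _ _ => smul_mul_star_smul α _ _).trans σ.defectFree_e
  defectFree_f := (Finset.sum_congr rfl fun _ _ => smul_mul_star_smul β _ _).trans σ.defectFree_f

end StarRep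

/-- The bounded families `(a_σ)`, where `σ` runs through all `*`-representations and
`a_σ ∈ B(H_σ)`: the C*-algebra `∏_σ B(H_σ)` with the supremum norm. -/
abbrev RepProduct (θ : Equiv.Perm (Fin m × Fin n)) : Type 1 :=
  lp (fun σ : StarRep θ => σ.H →L[ℂ] σ.H) ∞

/-- The image `(σ(w))_σ` of the word `w` under the sum of all `*`-representations. -/
def universalHom (θ : Equiv.Perm (Fin m × Fin n)) : TwoGraph θ →* RepProduct θ where
  toFun w := ⟨fun σ => σ.hom w, memℓp_infty ⟨1, by rintro _ ⟨σ, rfl⟩; exact (σ.norm_hom w).le⟩⟩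
  map_one' := by ext σ : 2; simp
  map_mul' := fun v w => by ext σ : 2; simp

noncomputable instance : CStarAlgebra (RepProduct θ) where

/-- The universal C*-algebra of the `*`-representations of `𝔽_θ⁺`, as the C*-algebra generated by
the images of the words under the sum of all `*`-representations. -/
noncomputable def cstarSubalgebra (θ : Equiv.Perm (Fin m × Fin n)) :
    StarSubalgebra ℂ (RepProduct θ) :=
  (StarAlgebra.adjoin ℂ (Set.range (universalHom θ))).topologicalClosure

instance : IsClosed (cstarSubalgebra θ : Set (RepProduct θ)) :=
  StarSubalgebra.isClosed_topologicalClosure _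

/-- `C*(𝔽_θ⁺)`. -/
def CStar (θ : Equiv.Perm (Fin m × Fin n)) : Type 1 := cstarSubalgebra θ

noncomputable instance : CStarAlgebra (CStar θ) :=
  inferInstanceAs (CStarAlgebra (cstarSubalgebra θ))

/-- The inclusion of `C*(𝔽_θ⁺)` into the product. -/
noncomputable def CStar.incl (θ : Equiv.Perm (Fin m × Fin n)) : CStar θ →⋆ₐ[ℂ] RepProduct θ :=
  (cstarSubalgebra θ).subtype

theorem CStar.incl_injective : Function.Injective (CStar.incl θ) := Subtype.val_injective

theorem CStar.norm_incl (a : CStar θ) : ‖CStar.incl θ a‖ = ‖a‖ := rfl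

/-- The canonical homomorphism `𝔽_θ⁺ → C*(𝔽_θ⁺)`. -/
noncomputable def word (θ : Equiv.Perm (Fin m × Fin n)) : TwoGraph θ →* CStar θ where
  toFun w := ⟨universalHom θ w, StarSubalgebra.le_topologicalClosure _
    (StarAlgebra.subset_adjoin ℂ _ ⟨w, rfl⟩)⟩
  map_one' := Subtype.ext (map_one (universalHom θ))
  map_mul' v w := Subtype.ext (map_mul (universalHom θ) v w)

/-! ### Gauge automorphisms and the expectation -/

/-- The `*`-endomorphism `(a_σ)_σ ↦ (a_{σ'})_σ` of the product, where `σ'` is `σ` twisted by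
`α, β`. -/
noncomputable def gaugeProduct (θ : Equiv.Perm (Fin m × Fin n)) (α β : Circle) :
    RepProduct θ →⋆ₐ[ℂ] RepProduct θ where
  toFun a := ⟨fun σ => a (σ.twist α β), memℓp_infty (by
    obtain ⟨C, hC⟩ := memℓp_infty_iff.1 a.2
    exact ⟨C, by rintro _ ⟨σ, rfl⟩; exact hC ⟨σ.twist α β, rfl⟩⟩)⟩
  map_one' := rfl
  map_mul' _ _ := rfl
  map_zero' := rfl
  map_add' _ _ := rfl
  commutes' _ := rfl
  map_star' _ := rfl

theorem gaugeProduct_universalHom (α β : Circle) (w : TwoGraph θ) :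
    gaugeProduct θ α β (universalHom θ w) =
      ((countHom θ α β w : Circle) : ℂ) • universalHom θ w := rfl

theorem continuous_gaugeProduct (α β : Circle) : Continuous (gaugeProduct θ α β) :=
  AddMonoidHomClass.continuous_of_bound (gaugeProduct θ α β) 1 fun a => by
    rw [one_mul]
    exact lp.norm_le_of_forall_le (norm_nonneg a)
      fun σ => lp.norm_apply_le_norm ENNReal.top_ne_zero a (σ.twist α β)

theorem gaugeProduct_mem (α β : Circle) {a : RepProduct θ} (ha : a ∈ cstarSubalgebra θ) :
    gaugeProduct θ α β a ∈ cstarSubalgebra θ := by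
  suffices h : cstarSubalgebra θ ≤ (cstarSubalgebra θ).comap (gaugeProduct θ α β) from h ha
  refine StarSubalgebra.topologicalClosure_minimal ?_
    ((StarSubalgebra.isClosed_topologicalClosure _).preimage (continuous_gaugeProduct α β))
  refine StarAlgebra.adjoin_le ?_
  rintro _ ⟨w, rfl⟩
  exact SMulMemClass.smul_mem _ (word θ w).2

/-- The gauge automorphism `γ_{α,β}`, which maps `e_i` to `α e_i` and `f_j` to `β f_j`. -/
noncomputable def gauge (θ : Equiv.Perm (Fin m × Fin n)) (α β : Circle) :
    CStar θ →⋆ₐ[ℂ] CStar θ :=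
  (((gaugeProduct θ α β).comp (cstarSubalgebra θ).subtype).codRestrict (cstarSubalgebra θ)
    fun a => gaugeProduct_mem α β a.2 : cstarSubalgebra θ →⋆ₐ[ℂ] cstarSubalgebra θ)

theorem gauge_word_e (α β : Circle) (i : Fin m) :
    gauge θ α β (word θ (e θ i)) = (α : ℂ) • word θ (e θ i) := rfl

theorem gauge_word_f (α β : Circle) (j : Fin n) :
    gauge θ α β (word θ (f θ j)) = (β : ℂ) • word θ (f θ j) := rfl

/-- The expectation `Φ(X) = ∫ γ_{α,β}(X) dα dβ`, for normalised Lebesgue measure on the torus. -/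
noncomputable def expectation (θ : Equiv.Perm (Fin m × Fin n)) (X : CStar θ) : CStar θ :=
  ∫ s in (0 : ℝ)..1, ∫ t in (0 : ℝ)..1,
    gauge θ (Circle.exp (2 * Real.pi * s)) (Circle.exp (2 * Real.pi * t)) X

/-- The matrix algebra `𝔉_k` spanned by the matrix units `x y*`, where `x, y` have degree
`(k, k)`. -/
noncomputable def matrixLevel (θ : Equiv.Perm (Fin m × Fin n)) (k : ℕ) : Submodule ℂ (CStar θ) :=
  Submodule.span ℂ {a | ∃ x y : TwoGraph θ, degree x = (k, k) ∧ degree y = (k, k) ∧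
    a = word θ x * star (word θ y)}

/-- The UHF core `𝔉`, the closure of the union of the algebras `𝔉_k` for `k ≥ 1`. -/
noncomputable def uhfCore (θ : Equiv.Perm (Fin m × Fin n)) : Set (CStar θ) :=
  closure (⋃ k : ℕ, ⋃ _ : 1 ≤ k, (matrixLevel θ k : Set (CStar θ)))

end TwoGraph

namespace TwoGraph

variable {m n : ℕ} {θ : Equiv.Perm (Fin m × Fin n)}

/-! ### Unique factorization -/

/-! The algebra is the closed span of the elements `u v*`, and each of these is an eigenvector of
the gauge action. Hence `Φ` fixes `u v*` when `d(u) = d(v)` and kills it otherwise. Refining by the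
words of a complementary degree puts the fixed ones into some `𝔉_k`, so density gives the range of
`Φ`.

Put `W = ∑ x t x*` over `d(x) = (k,k)`. Orthogonality of these words gives `x* W = t x*`
(`star_word_mul_corner`). Therefore `W* A W = A` on `𝔉_k`, in particular for `A = 1`. If `d(u) ≠
d(v)`, both at most `(k,k)`, then `W* u v* W` is a sum of terms `x (x't)* (y't) y*` with `x = u x'`
and `y = v y'`, so `d(x') ≠ d(y')`. Such a term vanishes as soon as `x't` and `y't` have no common
right multiple.

Aperiodicity supplies such a `t` (`IsAperiodic.exists_separating`). Take `τ` with trivial symmetry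
group. If `xτ_T` and `yτ_T` had common right multiples for every `T`, unique factorization would
force the labels of `τ` to repeat under the shift `d(y) - d(x)`, which would then lie in `H_τ`; so
`d(x) = d(y)`. Only finitely many pairs matter for a given `k`, so one long segment of `τ` serves
them all. Thus `W_k* A W_k = Φ(A)` exactly for large `k` on a dense subspace, and contractivity
extends the limit to all `A`. -/

theorem e_mul_f (i : Fin m) (j : Fin n) :
    e θ i * f θ j = f θ (θ (i, j)).2 * e θ (θ (i, j)).1 :=
  PresentedMonoid.mk_eq_mk_of_rel (Rel.comm i j)

theorem f_mul_e (i : Fin m) (j : Fin n) :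
    f θ j * e θ i = e θ (θ.symm (i, j)).1 * f θ (θ.symm (i, j)).2 := by
  rw [e_mul_f, Prod.mk.eta, Equiv.apply_symm_apply]

/-- Moving `f_j` from the left to the right of the word `e_u`: if `f_j e_u = e_{u'} f_{j'}`, the
result is `(u', j')`. -/
def pushF (θ : Equiv.Perm (Fin m × Fin n)) : Fin n → List (Fin m) → List (Fin m) × Fin n
  | j, [] => ([], j)
  | j, i :: u =>
    ((θ.symm (i, j)).1 :: (pushF θ (θ.symm (i, j)).2 u).1, (pushF θ (θ.symm (i, j)).2 u).2)

/-- The move can be undone from the right: induction recovers the `f` that emerges after the first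
`e`, and injectivity of `θ.symm` then recovers both original letters. -/
theorem pushF_injective {j j' : Fin n} {u u' : List (Fin m)} (h : pushF θ j u = pushF θ j' u') :
    j = j' ∧ u = u' := by
  induction u generalizing j j' u' with
  | nil =>
    cases u' with
    | nil => simpa [pushF] using h
    | cons i' u' => simp [pushF] at h
  | cons i u ih =>
    cases u' with
    | nil => simp [pushF] at h
    | cons i' u' =>
      simp only [pushF, Prod.mk.injEq, List.cons.injEq] at h
      obtain ⟨h2, rfl⟩ := ih (Prod.ext h.1.2 h.2)
      have := θ.symm.injective (Prod.ext h.1.1 h2)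
      simp_all

/-- Left multiplication by a generator on the normal forms `e_u f_v`. -/
def letterAction (θ : Equiv.Perm (Fin m × Fin n)) :
    Fin m ⊕ Fin n → Function.End (List (Fin m) × List (Fin n))
  | Sum.inl i => fun p => (i :: p.1, p.2)
  | Sum.inr j => fun p => ((pushF θ j p.1).1, (pushF θ j p.1).2 :: p.2)

/-- Left multiplication on the normal forms `e_u f_v`. -/
def wordAction (θ : Equiv.Perm (Fin m × Fin n)) :
    TwoGraph θ →* Function.End (List (Fin m) × List (Fin n)) :=
  PresentedMonoid.lift (letterAction θ) (by
    rintro _ _ ⟨i, j⟩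
    refine funext fun p => ?_
    -- On the right, `f_{j'}` first crosses `e_{i'}`; this applies `θ.symm` to `θ (i, j)`, returning
    -- `e_i` and leaving `f_j` to cross the rest.
    change letterAction θ (Sum.inl i) (letterAction θ (Sum.inr j) p) =
      letterAction θ (Sum.inr (θ (i, j)).2) (letterAction θ (Sum.inl (θ (i, j)).1) p)
    simp [letterAction, pushF])

/-- The normal form `e_u f_v` of a word, given as `(u, v)`. -/
def normalForm (w : TwoGraph θ) : List (Fin m) × List (Fin n) := wordAction θ w ([], [])

theorem normalForm_e_mul (i : Fin m) (w : TwoGraph θ) :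
    normalForm (e θ i * w) = (i :: (normalForm w).1, (normalForm w).2) := by
  rw [normalForm, map_mul]; rfl

theorem normalForm_f_mul (j : Fin n) (w : TwoGraph θ) :
    normalForm (f θ j * w) =
      ((pushF θ j (normalForm w).1).1, (pushF θ j (normalForm w).1).2 :: (normalForm w).2) := by
  rw [normalForm, map_mul]; rfl

/-- The word `e_u f_v`. -/
def ofNormalForm (θ : Equiv.Perm (Fin m × Fin n)) (p : List (Fin m) × List (Fin n)) : TwoGraph θ :=
  (p.1.map (e θ)).prod * (p.2.map (f θ)).prod

theorem f_mul_prod (j : Fin n) (u : List (Fin m)) :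
    f θ j * (u.map (e θ)).prod = ((pushF θ j u).1.map (e θ)).prod * f θ (pushF θ j u).2 := by
  induction u generalizing j with
  | nil => simp [pushF]
  | cons i u ih =>
    simp only [List.map_cons, List.prod_cons, pushF]
    rw [← mul_assoc, f_mul_e, mul_assoc, ih, mul_assoc]

/-- A word is recovered from its action on the empty normal form. Equality of words can therefore be
tested on normal forms, which is what makes left cancellation provable from the presentation. -/
theorem ofNormalForm_normalForm (w : TwoGraph θ) : ofNormalForm θ (normalForm w) = w := by
  induction w using induction_word with
  | h1 => simp [normalForm, ofNormalForm, Function.End.one_def]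
  | he i w ih =>
    rw [normalForm_e_mul]
    conv_rhs => rw [← ih]
    simp [ofNormalForm, mul_assoc]
  | hf j w ih =>
    rw [normalForm_f_mul]
    conv_rhs => rw [← ih]
    simp only [ofNormalForm, List.map_cons, List.prod_cons]
    rw [← mul_assoc, ← f_mul_prod, mul_assoc]

theorem normalForm_injective : Function.Injective (normalForm (θ := θ)) :=
  Function.LeftInverse.injective ofNormalForm_normalForm

theorem e_mul_inj {i i' : Fin m} {w w' : TwoGraph θ} (h : e θ i * w = e θ i' * w') :
    i = i' ∧ w = w' := by
  have h := congrArg normalForm h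
  simp only [normalForm_e_mul, Prod.mk.injEq, List.cons.injEq] at h
  exact ⟨h.1.1, normalForm_injective (Prod.ext h.1.2 h.2)⟩

theorem f_mul_inj {j j' : Fin n} {w w' : TwoGraph θ} (h : f θ j * w = f θ j' * w') :
    j = j' ∧ w = w' := by
  have h := congrArg normalForm h
  simp only [normalForm_f_mul, Prod.mk.injEq, List.cons.injEq] at h
  obtain ⟨h1, h2⟩ := pushF_injective (Prod.ext h.1 h.2.1)
  exact ⟨h1, normalForm_injective (Prod.ext h2 h.2.2)⟩

theorem exists_e_mul (w : TwoGraph θ) (h : 0 < (degree w).1) : ∃ i w', w = e θ i * w' := by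
  induction w using induction_word with
  | h1 => simp at h
  | he i w _ => exact ⟨i, w, rfl⟩
  | hf j w ih =>
    obtain ⟨i, w', rfl⟩ := ih (by simpa using h)
    exact ⟨_, _, by rw [← mul_assoc, f_mul_e, mul_assoc]⟩

theorem exists_f_mul (w : TwoGraph θ) (h : 0 < (degree w).2) : ∃ j w', w = f θ j * w' := by
  induction w using induction_word with
  | h1 => simp at h
  | hf j w _ => exact ⟨j, w, rfl⟩
  | he i w ih =>
    obtain ⟨j, w', rfl⟩ := ih (by simpa using h)
    exact ⟨_, _, by rw [← mul_assoc, e_mul_f, mul_assoc]⟩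

theorem eq_one_of_degree_eq_zero {w : TwoGraph θ} (h : degree w = 0) : w = 1 := by
  induction w using induction_word with
  | h1 => rfl
  | he i w _ => simpa using congrArg Prod.fst h
  | hf j w _ => simpa using congrArg Prod.snd h

/-- Since the degrees agree, `u'` can be rewritten to begin with the same kind of letter as `u`;
these letters coincide and cancel, and induction continues. -/
theorem mul_inj_of_degree_eq {u u' v v' : TwoGraph θ} (hd : degree u = degree u')
    (h : u * v = u' * v') : u = u' ∧ v = v' := by
  induction u using induction_word generalizing u' with
  | h1 =>
    obtain rfl := eq_one_of_degree_eq_zero (hd.symm.trans degree_one)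
    simpa using h
  | he i u ih =>
    obtain ⟨i', u', rfl⟩ := exists_e_mul u' (by simp [← hd])
    rw [mul_assoc, mul_assoc] at h
    obtain ⟨rfl, h'⟩ := e_mul_inj h
    obtain ⟨rfl, rfl⟩ := ih (by simpa using hd) h'
    exact ⟨rfl, rfl⟩
  | hf j u ih =>
    obtain ⟨j', u', rfl⟩ := exists_f_mul u' (by simp [← hd])
    rw [mul_assoc, mul_assoc] at h
    obtain ⟨rfl, h'⟩ := f_mul_inj h
    obtain ⟨rfl, rfl⟩ := ih (by simpa using hd) h'
    exact ⟨rfl, rfl⟩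

theorem exists_mul_of_le_degree (w : TwoGraph θ) (d : ℕ × ℕ) (h : d ≤ degree w) :
    ∃ u v, degree u = d ∧ w = u * v := by
  obtain ⟨k, l⟩ := d
  induction k generalizing w with
  | zero =>
    induction l generalizing w with
    | zero => exact ⟨1, w, rfl, (one_mul w).symm⟩
    | succ l ih =>
      obtain ⟨j, w, rfl⟩ := exists_f_mul w (lt_of_lt_of_le (Nat.succ_pos l) h.2)
      obtain ⟨u, v, hu, rfl⟩ := ih w ⟨Nat.zero_le _, by have := h.2; simp at this; omega⟩
      exact ⟨f θ j * u, v, by simp [hu, add_comm], (mul_assoc _ _ _).symm⟩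
  | succ k ih =>
    obtain ⟨i, w, rfl⟩ := exists_e_mul w (lt_of_lt_of_le (Nat.succ_pos k) h.1)
    obtain ⟨u, v, hu, rfl⟩ := ih w ⟨by have := h.1; simp at this; omega, by simpa using h.2⟩
    exact ⟨e θ i * u, v, by simp [hu, add_comm], (mul_assoc _ _ _).symm⟩

/-! ### Separating the translates of an initial segment -/

theorem degree_initial (τ : Tail m n) (T : ℕ) : degree (τ.initial θ T) = (T, T) := by
  induction T with
  | zero => rfl
  | succ T ih => simp [Tail.initial, ih]

theorem exists_initial_mul (τ : Tail m n) {S T : ℕ} (h : S ≤ T) :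
    ∃ v, τ.initial θ T = τ.initial θ S * v := by
  induction T, h using Nat.le_induction with
  | base => exact ⟨1, (mul_one _).symm⟩
  | succ T _ ih =>
    obtain ⟨v, hv⟩ := ih
    exact ⟨_, by rw [Tail.initial, hv, mul_assoc]⟩

/-- If the translates `x τ` and `y τ` of an infinite word `τ` agree, then a letter `g` found in `τ`
at `(a, b)` is also found at `(a, b) + d(x) - d(y)`. -/
theorem exists_factor_of_translates {τ : Tail m n} {x y : TwoGraph θ}
    (h : ∀ T, ∃ a b, x * τ.initial θ T * a = y * τ.initial θ T * b) {g : TwoGraph θ}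
    (hg : degree g ≤ (1, 1)) {d d' : ℕ × ℕ} (hd : degree x + d = degree y + d')
    (hT : ∃ (T : ℕ) (w₁ w : TwoGraph θ), degree w₁ = d ∧ τ.initial θ T = w₁ * (g * w)) :
    ∃ (T : ℕ) (w₁ w : TwoGraph θ), degree w₁ = d' ∧ τ.initial θ T = w₁ * (g * w) := by
  obtain ⟨S, w₁, w, hw₁, hS⟩ := hT
  -- Long enough to extend `τ_S` and to contain a prefix of degree `d' + d(g)`, because `d(g) ≤ (1,
  -- 1)`.
  set T := S + (d'.1 + d'.2 + 1)
  obtain ⟨v, hv⟩ := exists_initial_mul (θ := θ) τ (show S ≤ T by omega)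
  obtain ⟨a, b, hab⟩ := h T
  obtain ⟨u, z, hu, hz⟩ := exists_mul_of_le_degree (τ.initial θ T) (d' + degree g) (by
    rw [degree_initial]
    have h1 := hg.1
    have h2 := hg.2
    constructor <;> simp only [Prod.fst_add, Prod.snd_add] at * <;> omega)
  obtain ⟨u₁, g', hu₁, rfl⟩ := exists_mul_of_le_degree u d' (by rw [hu]; simp)
  have hg' : degree g' = degree g := by simpa [hu₁] using hu
  -- Two factorizations of the common multiple, cut at the same degree `d(x) + d = d(y) + d'`; the
  -- next factors `g` and `g'` also have equal degree, so they coincide.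
  have key : (x * w₁) * (g * (w * v * a)) = (y * u₁) * (g' * (z * b)) := by
    have : x * (w₁ * (g * w) * v) * a = y * (u₁ * g' * z) * b := by rw [← hS, ← hv, ← hz, hab]
    simpa only [mul_assoc] using this
  obtain ⟨-, key⟩ := mul_inj_of_degree_eq (by simp [hw₁, hu₁, hd]) key
  obtain ⟨rfl, -⟩ := mul_inj_of_degree_eq hg'.symm key
  exact ⟨T, u₁, z, hu₁, by rw [hz, mul_assoc]⟩

theorem degree_eq_of_translates {τ : Tail m n} (hτ : symmetryGroup θ τ = {(0, 0)})
    {x y : TwoGraph θ} (h : ∀ T, ∃ a b, x * τ.initial θ T * a = y * τ.initial θ T * b) :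
    degree x = degree y := by
  have h' : ∀ T, ∃ a b, y * τ.initial θ T * a = x * τ.initial θ T * b := fun T => by
    obtain ⟨a, b, hab⟩ := h T
    exact ⟨b, a, hab.symm⟩
  have hmem : (((degree y).1 : ℤ) - (degree x).1, ((degree y).2 : ℤ) - (degree x).2) ∈
      symmetryGroup θ τ := by
    -- The labels agree wherever both are defined, so the threshold `0` suffices.
    refine ⟨0, fun s t _ _ hs ht hs' ht' => ?_⟩
    have hd : degree x + (s.natAbs, t.natAbs) = degree y +
        ((s + ((degree y).1 - (degree x).1)).natAbs,
          (t + ((degree y).2 - (degree x).2)).natAbs) := by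
      ext <;> simp only [Prod.fst_add, Prod.snd_add] at * <;> omega
    exact ⟨fun i => ⟨exists_factor_of_translates h' (by simp) hd.symm,
        exists_factor_of_translates h (by simp) hd⟩,
      fun j => ⟨exists_factor_of_translates h' (by simp) hd.symm,
        exists_factor_of_translates h (by simp) hd⟩⟩
  rw [hτ, Set.mem_singleton_iff, Prod.mk.injEq] at hmem
  ext <;> omega

theorem IsAperiodic.exists_separating (hθ : IsAperiodic θ) (k : ℕ) :
    ∃ t : TwoGraph θ, ∀ x y : TwoGraph θ, degree x ≤ (k, k) → degree y ≤ (k, k) →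
      degree x ≠ degree y → ∀ a b, x * t * a ≠ y * t * b := by
  obtain ⟨τ, hτ⟩ := hθ
  have hfin : {w : TwoGraph θ | degree w ≤ (k, k)}.Finite :=
    ((Set.finite_Iic (k, k)).biUnion fun d _ => finite_degree (θ := θ) d).subset
      fun w hw => Set.mem_biUnion hw rfl
  have hsep : ∀ p : TwoGraph θ × TwoGraph θ, ∃ T, degree p.1 ≠ degree p.2 →
      ∀ a b, p.1 * τ.initial θ T * a ≠ p.2 * τ.initial θ T * b := fun p => by
    by_contra! hp
    exact (hp 0).1 (degree_eq_of_translates hτ fun T => (hp T).2)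
  choose T hT using hsep
  -- A common right multiple of `x τ_M` and `y τ_M` is also one of `x τ_T` and `y τ_T` for `T ≤ M`,
  -- so lengthening the segment preserves separation.
  obtain ⟨M, hM⟩ := ((hfin.prod hfin).image T).bddAbove
  refine ⟨τ.initial θ M, fun x y hx hy hxy a b hab => ?_⟩
  obtain ⟨v, hv⟩ := exists_initial_mul (θ := θ) τ (hM ⟨(x, y), ⟨hx, hy⟩, rfl⟩)
  refine hT (x, y) hxy (v * a) (v * b) ?_
  simpa only [hv, mul_assoc] using hab

/-! ### Relations in the universal C*-algebra -/

theorem CStar.ext_rep {a b : CStar θ} (h : ∀ σ : StarRep θ, CStar.incl θ a σ = CStar.incl θ b σ) :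
    a = b :=
  CStar.incl_injective (by ext σ : 2; exact h σ)

theorem star_word_mul_word (w : TwoGraph θ) : star (word θ w) * word θ w = 1 :=
  CStar.ext_rep fun σ => σ.star_hom_mul_hom w

theorem star_word_e_mul_word_e (i i' : Fin m) :
    star (word θ (e θ i)) * word θ (e θ i') = if i = i' then 1 else 0 :=
  CStar.ext_rep fun σ => (σ.isometric_e i i').trans (by split_ifs <;> simp)

theorem star_word_f_mul_word_f (j j' : Fin n) :
    star (word θ (f θ j)) * word θ (f θ j') = if j = j' then 1 else 0 :=
  CStar.ext_rep fun σ => (σ.isometric_f j j').trans (by split_ifs <;> simp)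

theorem sum_word_e : ∑ i, word θ (e θ i) * star (word θ (e θ i)) = 1 :=
  CStar.ext_rep fun σ => by
    simp only [map_sum, map_mul, map_star, map_one, lp.coeFn_sum, Finset.sum_apply]
    exact σ.defectFree_e

theorem sum_word_f : ∑ j, word θ (f θ j) * star (word θ (f θ j)) = 1 :=
  CStar.ext_rep fun σ => by
    simp only [map_sum, map_mul, map_star, map_one, lp.coeFn_sum, Finset.sum_apply]
    exact σ.defectFree_f

theorem star_word_mul_word_of_ne {x y : TwoGraph θ} (hd : degree x = degree y) (hxy : x ≠ y) :
    star (word θ x) * word θ y = 0 := by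
  induction x using induction_word generalizing y with
  | h1 => exact absurd (eq_one_of_degree_eq_zero (hd.symm.trans degree_one)).symm hxy
  | he i x ih =>
    obtain ⟨i', y, rfl⟩ := exists_e_mul y (by simp [← hd])
    rw [map_mul, map_mul, star_mul, mul_assoc, ← mul_assoc (star (word θ (e θ i))),
      star_word_e_mul_word_e]
    split_ifs with h
    · subst h
      rw [one_mul]
      exact ih (by simpa using hd) fun h => hxy (by rw [h])
    · simp
  | hf j x ih =>
    obtain ⟨j', y, rfl⟩ := exists_f_mul y (by simp [← hd])
    rw [map_mul, map_mul, star_mul, mul_assoc, ← mul_assoc (star (word θ (f θ j))),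
      star_word_f_mul_word_f]
    split_ifs with h
    · subst h
      rw [one_mul]
      exact ih (by simpa using hd) fun h => hxy (by rw [h])
    · simp

/-- The finite set of words of degree `d`. -/
noncomputable def wordsOfBidegree (θ : Equiv.Perm (Fin m × Fin n)) (d : ℕ × ℕ) :
    Finset (TwoGraph θ) :=
  (finite_degree (θ := θ) d).toFinset

@[simp] theorem mem_wordsOfBidegree {d : ℕ × ℕ} {w : TwoGraph θ} :
    w ∈ wordsOfBidegree θ d ↔ degree w = d := by simp [wordsOfBidegree]

@[simp] theorem mem_wordsOfDegree {k : ℕ} {w : TwoGraph θ} :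
    w ∈ wordsOfDegree θ k ↔ degree w = (k, k) := by simp [wordsOfDegree]

theorem sum_wordsOfBidegree_succ_left {M : Type*} [AddCommMonoid M] (F : TwoGraph θ → M)
    (k l : ℕ) :
    ∑ x ∈ wordsOfBidegree θ (k + 1, l), F x =
      ∑ i, ∑ x ∈ wordsOfBidegree θ (k, l), F (e θ i * x) := by
  rw [← Finset.sum_product']
  symm
  refine Finset.sum_bij (fun p _ => e θ p.1 * p.2) (fun p hp => ?_) (fun p _ q _ h => ?_)
    (fun x hx => ?_) fun _ _ => rfl
  · simp only [Finset.mem_product, Finset.mem_univ, mem_wordsOfBidegree, true_and] at hp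
    simp [hp, add_comm]
  · exact Prod.ext (e_mul_inj h).1 (e_mul_inj h).2
  · rw [mem_wordsOfBidegree] at hx
    obtain ⟨i, x, rfl⟩ := exists_e_mul x (by simp [hx])
    refine ⟨(i, x), ?_, rfl⟩
    simp only [degree_mul, degree_e, Prod.ext_iff, Prod.fst_add, Prod.snd_add] at hx
    simp only [Finset.mem_product, Finset.mem_univ, mem_wordsOfBidegree, true_and]
    ext <;> omega

theorem sum_wordsOfBidegree_succ_right {M : Type*} [AddCommMonoid M] (F : TwoGraph θ → M)
    (k l : ℕ) :
    ∑ x ∈ wordsOfBidegree θ (k, l + 1), F x =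
      ∑ j, ∑ x ∈ wordsOfBidegree θ (k, l), F (f θ j * x) := by
  rw [← Finset.sum_product']
  symm
  refine Finset.sum_bij (fun p _ => f θ p.1 * p.2) (fun p hp => ?_) (fun p _ q _ h => ?_)
    (fun x hx => ?_) fun _ _ => rfl
  · simp only [Finset.mem_product, Finset.mem_univ, mem_wordsOfBidegree, true_and] at hp
    simp [hp, add_comm]
  · exact Prod.ext (f_mul_inj h).1 (f_mul_inj h).2
  · rw [mem_wordsOfBidegree] at hx
    obtain ⟨j, x, rfl⟩ := exists_f_mul x (by simp [hx])
    refine ⟨(j, x), ?_, rfl⟩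
    simp only [degree_mul, degree_f, Prod.ext_iff, Prod.fst_add, Prod.snd_add] at hx
    simp only [Finset.mem_product, Finset.mem_univ, mem_wordsOfBidegree, true_and]
    ext <;> omega

/-- Splitting off the first letter reduces each degree to the previous one and the defect-free
relation. -/
theorem sum_word_mul_star_word (d : ℕ × ℕ) :
    ∑ x ∈ wordsOfBidegree θ d, word θ x * star (word θ x) = 1 := by
  have step (v : TwoGraph θ) (d : ℕ × ℕ)
      (ih : ∑ x ∈ wordsOfBidegree θ d, word θ x * star (word θ x) = 1) :
      ∑ x ∈ wordsOfBidegree θ d, word θ (v * x) * star (word θ (v * x)) =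
        word θ v * star (word θ v) := by
    calc _ = word θ v * (∑ x ∈ wordsOfBidegree θ d, word θ x * star (word θ x)) *
          star (word θ v) := by
          simp only [Finset.mul_sum, Finset.sum_mul, map_mul, star_mul, mul_assoc]
      _ = _ := by rw [ih, mul_one]
  obtain ⟨k, l⟩ := d
  induction k with
  | zero =>
    induction l with
    | zero =>
      have : wordsOfBidegree θ (0, 0) = {1} := by
        ext w
        rw [mem_wordsOfBidegree, Finset.mem_singleton]
        exact ⟨eq_one_of_degree_eq_zero, fun h => h ▸ degree_one⟩
      simp [this]
    | succ l ih =>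
      rw [sum_wordsOfBidegree_succ_right]
      simp only [step _ _ ih, sum_word_f]
  | succ k ih =>
    rw [sum_wordsOfBidegree_succ_left]
    simp only [step _ _ ih, sum_word_e]

/-! ### The dense span of the elements `x y*` -/

/-- The span of the elements `x y*`. -/
noncomputable def wordSpan (θ : Equiv.Perm (Fin m × Fin n)) : Submodule ℂ (CStar θ) :=
  Submodule.span ℂ {a | ∃ x y : TwoGraph θ, a = word θ x * star (word θ y)}

theorem word_mul_star_word_mem (x y : TwoGraph θ) : word θ x * star (word θ y) ∈ wordSpan θ :=
  Submodule.subset_span ⟨x, y, rfl⟩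

theorem star_mem_wordSpan {a : CStar θ} (ha : a ∈ wordSpan θ) : star a ∈ wordSpan θ := by
  induction ha using Submodule.span_induction with
  | mem a ha =>
    obtain ⟨x, y, rfl⟩ := ha
    rw [star_mul, star_star]
    exact word_mul_star_word_mem y x
  | zero => simp
  | add a b _ _ ha hb => rw [star_add]; exact add_mem ha hb
  | smul c a _ ha => rw [star_smul]; exact Submodule.smul_mem _ _ ha

theorem star_word_mul_word_mul (u : TwoGraph θ) (a : CStar θ) :
    star (word θ u) * (word θ u * a) = a := by
  rw [← mul_assoc, star_word_mul_word, one_mul]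

theorem star_word_mul_word_of_degree_le {x z : TwoGraph θ} (h : degree x ≤ degree z) :
    (∃ u, z = x * u ∧ star (word θ x) * word θ z = word θ u) ∨ star (word θ x) * word θ z = 0 := by
  obtain ⟨x', u, hx', rfl⟩ := exists_mul_of_le_degree z (degree x) h
  by_cases hx : x = x'
  · subst hx
    exact Or.inl ⟨u, rfl, by rw [map_mul, star_word_mul_word_mul]⟩
  · right
    rw [map_mul, ← mul_assoc, star_word_mul_word_of_ne hx'.symm hx, zero_mul]

/-- The identity is inserted as `∑ z z*` at the join of the degrees, where each of `x* z` and `y* z`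
is a word or zero. A nonzero term requires `z` to be a common right multiple of `x` and `y`. -/
theorem star_word_mul_word_eq_sum (x y : TwoGraph θ) :
    star (word θ x) * word θ y = ∑ z ∈ wordsOfBidegree θ (degree x ⊔ degree y),
      star (word θ x) * word θ z * star (star (word θ y) * word θ z) := by
  conv_lhs => rw [← mul_one (star (word θ x)),
    ← sum_word_mul_star_word (θ := θ) (degree x ⊔ degree y)]
  simp only [Finset.mul_sum, Finset.sum_mul, star_mul, star_star, mul_assoc]

theorem star_word_mul_word_mem (x y : TwoGraph θ) : star (word θ x) * word θ y ∈ wordSpan θ := by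
  rw [star_word_mul_word_eq_sum]
  refine sum_mem fun z hz => ?_
  rw [mem_wordsOfBidegree] at hz
  obtain ⟨u, -, hu⟩ | hu := star_word_mul_word_of_degree_le (x := x) (hz ▸ le_sup_left)
  · obtain ⟨v, -, hv⟩ | hv := star_word_mul_word_of_degree_le (x := y) (hz ▸ le_sup_right)
    · rw [hu, hv]
      exact word_mul_star_word_mem u v
    · simp [hv]
  · simp [hu]

theorem star_word_mul_word_eq_zero {x y : TwoGraph θ} (h : ∀ a b, x * a ≠ y * b) :
    star (word θ x) * word θ y = 0 := by
  rw [star_word_mul_word_eq_sum]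
  refine Finset.sum_eq_zero fun z hz => ?_
  rw [mem_wordsOfBidegree] at hz
  obtain ⟨u, hu, -⟩ | hu := star_word_mul_word_of_degree_le (x := x) (hz ▸ le_sup_left)
  · obtain ⟨v, hv, -⟩ | hv := star_word_mul_word_of_degree_le (x := y) (hz ▸ le_sup_right)
    · exact absurd (hu.symm.trans hv) (h u v)
    · simp [hv]
  · simp [hu]

theorem word_mul_mem (x : TwoGraph θ) {a : CStar θ} (ha : a ∈ wordSpan θ) :
    word θ x * a ∈ wordSpan θ := by
  induction ha using Submodule.span_induction with
  | mem a ha =>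
    obtain ⟨y, z, rfl⟩ := ha
    rw [← mul_assoc, ← map_mul]
    exact word_mul_star_word_mem _ z
  | zero => simp
  | add a b _ _ ha hb => rw [mul_add]; exact add_mem ha hb
  | smul c a _ ha => rw [mul_smul_comm]; exact Submodule.smul_mem _ _ ha

theorem star_word_mul_mem (x : TwoGraph θ) {a : CStar θ} (ha : a ∈ wordSpan θ) :
    star (word θ x) * a ∈ wordSpan θ := by
  induction ha using Submodule.span_induction with
  | mem a ha =>
    obtain ⟨y, z, rfl⟩ := ha
    -- `x* y z*` is the adjoint of `z (y* x)`.
    have h := star_mem_wordSpan (word_mul_mem z (star_word_mul_word_mem y x))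
    rwa [star_mul, star_mul, star_star, mul_assoc] at h
  | zero => simp
  | add a b _ _ ha hb => rw [mul_add]; exact add_mem ha hb
  | smul c a _ ha => rw [mul_smul_comm]; exact Submodule.smul_mem _ _ ha

theorem mul_mem_wordSpan {a b : CStar θ} (ha : a ∈ wordSpan θ) (hb : b ∈ wordSpan θ) :
    a * b ∈ wordSpan θ := by
  induction ha using Submodule.span_induction with
  | mem a ha =>
    obtain ⟨x, y, rfl⟩ := ha
    rw [mul_assoc]
    exact word_mul_mem x (star_word_mul_mem y hb)
  | zero => simp
  | add a a' _ _ ha ha' => rw [add_mul]; exact add_mem ha ha'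
  | smul c a _ ha => rw [smul_mul_assoc]; exact Submodule.smul_mem _ _ ha

theorem word_mem_wordSpan (x : TwoGraph θ) : word θ x ∈ wordSpan θ := by
  simpa using word_mul_star_word_mem x 1

theorem adjoin_subset_image_wordSpan :
    (StarAlgebra.adjoin ℂ (Set.range (universalHom θ)) : Set (RepProduct θ)) ⊆
      CStar.incl θ '' (wordSpan θ : Set (CStar θ)) := by
  intro a ha
  induction ha using StarAlgebra.adjoin_induction with
  | mem a ha =>
    obtain ⟨w, rfl⟩ := ha
    exact ⟨word θ w, word_mem_wordSpan w, rfl⟩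
  | algebraMap c =>
    refine ⟨c • word θ 1, Submodule.smul_mem _ _ (word_mem_wordSpan 1), ?_⟩
    rw [map_one, map_smul, map_one, Algebra.algebraMap_eq_smul_one]
  | add a b _ _ ha hb =>
    obtain ⟨a, ha, rfl⟩ := ha
    obtain ⟨b, hb, rfl⟩ := hb
    exact ⟨a + b, add_mem ha hb, map_add _ _ _⟩
  | mul a b _ _ ha hb =>
    obtain ⟨a, ha, rfl⟩ := ha
    obtain ⟨b, hb, rfl⟩ := hb
    exact ⟨a * b, mul_mem_wordSpan ha hb, map_mul _ _ _⟩
  | star a _ ha =>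
    obtain ⟨a, ha, rfl⟩ := ha
    exact ⟨star a, star_mem_wordSpan ha, map_star _ _⟩

theorem CStar.isInducing_incl : Topology.IsInducing (CStar.incl θ) :=
  (AddMonoidHomClass.isometry_of_norm (CStar.incl θ) CStar.norm_incl).isUniformInducing.isInducing

theorem dense_wordSpan : Dense (wordSpan θ : Set (CStar θ)) := by
  intro a
  rw [(CStar.isInducing_incl (θ := θ)).closure_eq_preimage_closure_image]
  exact closure_mono adjoin_subset_image_wordSpan a.2

/-! ### The expectation -/

theorem gauge_word (α β : Circle) (w : TwoGraph θ) :
    gauge θ α β (word θ w) = ((countHom θ α β w : Circle) : ℂ) • word θ w := rfl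

theorem countHom_eq (α β : Circle) (w : TwoGraph θ) :
    countHom θ α β w = α ^ (degree w).1 * β ^ (degree w).2 := by
  induction w using induction_word with
  | h1 => simp
  | he i w ih =>
    rw [map_mul, ih, show countHom θ α β (e θ i) = α from rfl]
    simp [pow_add, mul_assoc]
  | hf j w ih =>
    rw [map_mul, ih, show countHom θ α β (f θ j) = β from rfl]
    simp [pow_add, mul_left_comm]

theorem mul_pow_mul_inv {G : Type*} [CommGroup G] (a b : G) (k l k' l' : ℕ) :
    a ^ k * b ^ l * (a ^ k' * b ^ l')⁻¹ = a ^ (k - k' : ℤ) * b ^ (l - l' : ℤ) := by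
  rw [zpow_sub, zpow_sub, mul_inv, mul_mul_mul_comm]
  simp only [zpow_natCast]

theorem gauge_word_mul_star_word (α β : Circle) (x y : TwoGraph θ) :
    gauge θ α β (word θ x * star (word θ y)) =
      ((α ^ ((degree x).1 - (degree y).1 : ℤ) : Circle) : ℂ) •
        ((β ^ ((degree x).2 - (degree y).2 : ℤ) : Circle) : ℂ) •
          (word θ x * star (word θ y)) := by
  rw [map_mul, map_star, gauge_word, gauge_word, star_smul, smul_mul_smul_comm, Complex.star_def,
    ← Circle.coe_inv_eq_conj, ← Circle.coe_mul, smul_smul, ← Circle.coe_mul, countHom_eq,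
    countHom_eq]
  exact congrArg (fun c : Circle => (c : ℂ) • _) (mul_pow_mul_inv α β _ _ _ _)

theorem norm_gauge_le (α β : Circle) (X : CStar θ) : ‖gauge θ α β X‖ ≤ ‖X‖ :=
  NonUnitalStarAlgHom.norm_apply_le (gauge θ α β) X

/-- The gauge action, parametrised by `ℝ²`. -/
noncomputable def rotation (X : CStar θ) (s t : ℝ) : CStar θ :=
  gauge θ (Circle.exp (2 * Real.pi * s)) (Circle.exp (2 * Real.pi * t)) X

theorem expectation_eq (X : CStar θ) :
    expectation θ X = ∫ s in (0 : ℝ)..1, ∫ t in (0 : ℝ)..1, rotation X s t := rfl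

theorem continuous_circle_zpow (p : ℤ) :
    Continuous fun s : ℝ => ((Circle.exp (2 * Real.pi * s) ^ p : Circle) : ℂ) :=
  (by fun_prop : Continuous ((↑) : Circle → ℂ)).comp ((Circle.exp.continuous.comp (continuous_const_mul _)).zpow p)

theorem continuous_rotation_of_mem_wordSpan {X : CStar θ} (hX : X ∈ wordSpan θ) :
    Continuous fun p : ℝ × ℝ => rotation X p.1 p.2 := by
  induction hX using Submodule.span_induction with
  | mem a ha =>
    obtain ⟨x, y, rfl⟩ := ha
    simp only [rotation, gauge_word_mul_star_word]
    exact ((continuous_circle_zpow _).comp continuous_fst).smul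
      (((continuous_circle_zpow _).comp continuous_snd).smul continuous_const)
  | zero => simpa [rotation] using continuous_const
  | add a b _ _ ha hb =>
    simp only [rotation, map_add] at *
    exact ha.add hb
  | smul c a _ ha =>
    simp only [rotation, map_smul] at *
    exact ha.const_smul c

/-- Gauge maps are contractive, so the orbit map of `X` is a uniform limit of those of elements of
the span, which are trigonometric polynomials. -/
theorem continuous_rotation (X : CStar θ) : Continuous fun p : ℝ × ℝ => rotation X p.1 p.2 := by
  refine continuous_of_uniform_approx_of_continuous fun u hu => ?_
  obtain ⟨ε, hε, hu⟩ := Metric.mem_uniformity_dist.1 hu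
  obtain ⟨Y, hY, hXY⟩ := Metric.mem_closure_iff.1 (dense_wordSpan X) ε hε
  refine ⟨_, continuous_rotation_of_mem_wordSpan hY, fun p => hu ?_⟩
  rw [dist_eq_norm] at hXY ⊢
  rw [rotation, rotation, ← map_sub]
  exact (norm_gauge_le _ _ _).trans_lt hXY

theorem continuous_integral_rotation (X : CStar θ) :
    Continuous fun s => ∫ t in (0 : ℝ)..1, rotation X s t :=
  intervalIntegral.continuous_parametric_intervalIntegral_of_continuous'
    (continuous_rotation X) 0 1

theorem continuous_rotation_right (X : CStar θ) (s : ℝ) : Continuous fun t => rotation X s t := by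
  have h := (continuous_rotation X).comp (f := fun t : ℝ => (s, t)) (by fun_prop)
  simpa only [Function.comp_def] using h

/-- The expectation as a continuous linear map. -/
noncomputable def expectationL (θ : Equiv.Perm (Fin m × Fin n)) : CStar θ →L[ℂ] CStar θ :=
  LinearMap.mkContinuous
    { toFun := expectation θ
      map_add' := fun X Y => by
        rw [expectation_eq, expectation_eq, expectation_eq, ← intervalIntegral.integral_add
          ((continuous_integral_rotation X).intervalIntegrable _ _)
          ((continuous_integral_rotation Y).intervalIntegrable _ _)]
        refine intervalIntegral.integral_congr fun s _ => ?_
        rw [← intervalIntegral.integral_add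
          ((continuous_rotation_right X s).intervalIntegrable _ _)
          ((continuous_rotation_right Y s).intervalIntegrable _ _)]
        simp [rotation]
      map_smul' := fun c X => by
        simp only [expectation_eq, rotation, map_smul, intervalIntegral.integral_smul,
          RingHom.id_apply] }
    1 fun X => by
      rw [one_mul]
      have h1 (s : ℝ) : ‖∫ t in (0 : ℝ)..1, rotation X s t‖ ≤ ‖X‖ := by
        simpa using intervalIntegral.norm_integral_le_of_norm_le_const (a := (0 : ℝ)) (b := 1)
          (f := rotation X s) fun t _ => norm_gauge_le _ _ X
      have h2 : ‖∫ s in (0 : ℝ)..1, ∫ t in (0 : ℝ)..1, rotation X s t‖ ≤ ‖X‖ := by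
        simpa using intervalIntegral.norm_integral_le_of_norm_le_const (a := (0 : ℝ)) (b := 1)
          fun s _ => h1 s
      exact h2

@[simp] theorem expectationL_apply (X : CStar θ) : expectationL θ X = expectation θ X := rfl

theorem norm_expectation_le (X : CStar θ) : ‖expectation θ X‖ ≤ ‖X‖ := by
  simpa using (expectationL θ).le_of_opNorm_le (LinearMap.mkContinuous_norm_le _ zero_le_one _) X

theorem integral_circle_zpow (p : ℤ) :
    ∫ s in (0 : ℝ)..1, ((Circle.exp (2 * Real.pi * s) ^ p : Circle) : ℂ) =
      if p = 0 then 1 else 0 := by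
  split_ifs with h
  · simp [h]
  · have hc : (2 * Real.pi * p * Complex.I : ℂ) ≠ 0 := by simp [h, Real.pi_ne_zero]
    have : ∀ s : ℝ, ((Circle.exp (2 * Real.pi * s) ^ p : Circle) : ℂ) =
        Complex.exp ((2 * Real.pi * p * Complex.I : ℂ) * s) := fun s => by
      rw [Circle.coe_zpow, Circle.coe_exp, ← Complex.exp_int_mul]
      congr 1
      push_cast
      ring
    simp only [this]
    rw [integral_exp_mul_complex hc]
    have h1 : Complex.exp (2 * Real.pi * p * Complex.I) = 1 :=
      Complex.exp_eq_one_iff.2 ⟨p, by ring⟩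
    simp [h1]

theorem expectation_word_mul_star_word (x y : TwoGraph θ) :
    expectation θ (word θ x * star (word θ y)) =
      if degree x = degree y then word θ x * star (word θ y) else 0 := by
  simp only [expectation_eq, rotation, gauge_word_mul_star_word, intervalIntegral.integral_smul,
    intervalIntegral.integral_smul_const, integral_circle_zpow]
  have h : degree x = degree y ↔ ((degree x).1 - (degree y).1 : ℤ) = 0 ∧
      ((degree x).2 - (degree y).2 : ℤ) = 0 := by
    rw [Prod.ext_iff]; omega
  simp only [h, ite_and]
  split_ifs <;> simp

/-! ### The UHF core -/

/-- Inserting `∑ z z* = 1` with `d(z) = (k,k) - d(x)` writes `x y*` as a sum of matrix units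
`(xz)(yz)*`. The common degree need not be diagonal, which is why `𝔉` exhausts the range of `Φ`. -/
theorem word_mul_star_word_mem_matrixLevel {x y : TwoGraph θ} (hd : degree x = degree y) {k : ℕ}
    (hk : degree x ≤ (k, k)) : word θ x * star (word θ y) ∈ matrixLevel θ k := by
  have h : word θ x * star (word θ y) = ∑ z ∈ wordsOfBidegree θ ((k, k) - degree x),
      word θ (x * z) * star (word θ (y * z)) := by
    conv_lhs => rw [← mul_one (word θ x),
      ← sum_word_mul_star_word (θ := θ) ((k, k) - degree x)]
    simp only [Finset.mul_sum, Finset.sum_mul, map_mul, star_mul, mul_assoc]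
  rw [h]
  refine sum_mem fun z hz => Submodule.subset_span ⟨x * z, y * z, ?_, ?_, rfl⟩
  · rw [degree_mul, mem_wordsOfBidegree.1 hz, add_tsub_cancel_of_le hk]
  · rw [degree_mul, mem_wordsOfBidegree.1 hz, ← hd, add_tsub_cancel_of_le hk]

theorem matrixLevel_mono {j k : ℕ} (h : j ≤ k) : matrixLevel θ j ≤ matrixLevel θ k := by
  refine Submodule.span_le.2 ?_
  rintro _ ⟨x, y, hx, hy, rfl⟩
  exact word_mul_star_word_mem_matrixLevel (hx.trans hy.symm) (by rw [hx]; exact ⟨h, h⟩)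

theorem exists_expectation_mem_matrixLevel {X : CStar θ} (hX : X ∈ wordSpan θ) :
    ∃ k, 1 ≤ k ∧ expectation θ X ∈ matrixLevel θ k := by
  simp only [← expectationL_apply]
  induction hX using Submodule.span_induction with
  | mem X hX =>
    obtain ⟨x, y, rfl⟩ := hX
    -- The sum dominates both coordinates of the degree; the extra `1` ensures `k ≥ 1`.
    refine ⟨(degree x).1 + (degree x).2 + 1, by omega, ?_⟩
    rw [expectationL_apply, expectation_word_mul_star_word]
    split_ifs with h
    · exact word_mul_star_word_mem_matrixLevel h (by constructor <;> simp only <;> omega)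
    · exact zero_mem _
  | zero => exact ⟨1, le_rfl, by simp only [map_zero, zero_mem]⟩
  | add X Y _ _ hX hY =>
    obtain ⟨k, hk, hX⟩ := hX
    obtain ⟨l, -, hY⟩ := hY
    refine ⟨max k l, le_max_of_le_left hk, ?_⟩
    rw [map_add]
    exact add_mem (matrixLevel_mono (le_max_left k l) hX) (matrixLevel_mono (le_max_right k l) hY)
  | smul c X _ hX =>
    obtain ⟨k, hk, hX⟩ := hX
    exact ⟨k, hk, by rw [map_smul]; exact Submodule.smul_mem _ _ hX⟩

theorem expectation_mem_uhfCore (X : CStar θ) : expectation θ X ∈ uhfCore θ := by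
  have h : Set.MapsTo (expectationL θ) (wordSpan θ)
      (⋃ k : ℕ, ⋃ _ : 1 ≤ k, (matrixLevel θ k : Set (CStar θ))) := fun X hX => by
    obtain ⟨k, hk, hX⟩ := exists_expectation_mem_matrixLevel hX
    exact Set.mem_iUnion₂.2 ⟨k, hk, hX⟩
  exact h.closure (expectationL θ).continuous (dense_wordSpan X)

theorem expectation_eq_self_of_mem_matrixLevel {k : ℕ} {A : CStar θ} (hA : A ∈ matrixLevel θ k) :
    expectation θ A = A := by
  suffices h : matrixLevel θ k ≤ LinearMap.eqLocus (expectationL θ : CStar θ →ₗ[ℂ] CStar θ)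
    LinearMap.id from h hA
  refine Submodule.span_le.2 ?_
  rintro _ ⟨x, y, hx, hy, rfl⟩
  exact (expectation_word_mul_star_word x y).trans (if_pos (hx.trans hy.symm))

theorem expectation_eq_self_of_mem_uhfCore {A : CStar θ} (hA : A ∈ uhfCore θ) :
    expectation θ A = A := by
  refine closure_minimal (t := {A | expectation θ A = A}) ?_
    (isClosed_eq (expectationL θ).continuous continuous_id) hA
  exact Set.iUnion₂_subset fun k _ A hA => expectation_eq_self_of_mem_matrixLevel hA

theorem range_expectation : Set.range (expectation θ) = uhfCore θ := by
  ext A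
  refine ⟨?_, fun hA => ⟨A, expectation_eq_self_of_mem_uhfCore hA⟩⟩
  rintro ⟨X, rfl⟩
  exact expectation_mem_uhfCore X

/-! ### The isometries implementing the expectation -/

/-- The element `∑ x t x*`, where `x` runs through the words of degree `(k, k)`. -/
noncomputable def corner (k : ℕ) (t : TwoGraph θ) : CStar θ :=
  ∑ x ∈ wordsOfDegree θ k, word θ x * word θ t * star (word θ x)

theorem star_word_mul_corner {k : ℕ} (t : TwoGraph θ) {x : TwoGraph θ} (hx : degree x = (k, k)) :
    star (word θ x) * corner k t = word θ t * star (word θ x) := by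
  rw [corner, Finset.mul_sum, Finset.sum_eq_single x]
  · rw [mul_assoc, star_word_mul_word_mul]
  · intro y hy hyx
    rw [mul_assoc, ← mul_assoc, star_word_mul_word_of_ne
      (hx.trans (mem_wordsOfDegree.1 hy).symm) hyx.symm, zero_mul]
  · intro h
    exact absurd (mem_wordsOfDegree.2 hx) h

theorem star_corner_mul_mul_corner {k : ℕ} (t : TwoGraph θ) {x y : TwoGraph θ}
    (hx : degree x = (k, k)) (hy : degree y = (k, k)) :
    star (corner k t) * (word θ x * star (word θ y)) * corner k t =
      word θ x * star (word θ y) := by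
  calc _ = star (star (word θ x) * corner k t) * (star (word θ y) * corner k t) := by
        simp only [star_mul, star_star, mul_assoc]
    _ = _ := by
        rw [star_word_mul_corner t hx, star_word_mul_corner t hy, star_mul, star_star, mul_assoc,
          star_word_mul_word_mul]

theorem star_corner_mul_corner (k : ℕ) (t : TwoGraph θ) :
    star (corner k t) * corner k t = 1 := by
  have h := sum_word_mul_star_word (θ := θ) (k, k)
  calc star (corner k t) * corner k t
      = star (corner k t) * (∑ x ∈ wordsOfBidegree θ (k, k), word θ x * star (word θ x)) *
          corner k t := by rw [h, mul_one]
    _ = ∑ x ∈ wordsOfBidegree θ (k, k), word θ x * star (word θ x) := by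
        rw [Finset.mul_sum, Finset.sum_mul]
        exact Finset.sum_congr rfl fun x hx => star_corner_mul_mul_corner t
          (mem_wordsOfBidegree.1 hx) (mem_wordsOfBidegree.1 hx)
    _ = 1 := h

theorem star_corner_mul_mul_corner_of_mem {k : ℕ} (t : TwoGraph θ) {A : CStar θ}
    (hA : A ∈ matrixLevel θ k) : star (corner k t) * A * corner k t = A := by
  induction hA using Submodule.span_induction with
  | mem A hA =>
    obtain ⟨x, y, hx, hy, rfl⟩ := hA
    exact star_corner_mul_mul_corner t hx hy
  | zero => simp
  | add A B _ _ hA hB => rw [mul_add, add_mul, hA, hB]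
  | smul c A _ hA => rw [mul_smul_comm, smul_mul_assoc, hA]

/-- Only `x = u x'` and `y = v y'` contribute, and each contribution contains `(x't)* (y't)`, which
is zero because `t` separates `x'` from `y'`. -/
theorem star_corner_mul_mul_corner_eq_zero {k : ℕ} {t : TwoGraph θ}
    (ht : ∀ x y : TwoGraph θ, degree x ≤ (k, k) → degree y ≤ (k, k) →
      degree x ≠ degree y → ∀ a b, x * t * a ≠ y * t * b)
    {u v : TwoGraph θ} (hu : degree u ≤ (k, k)) (hv : degree v ≤ (k, k))
    (huv : degree u ≠ degree v) :
    star (corner k t) * (word θ u * star (word θ v)) * corner k t = 0 := by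
  calc star (corner k t) * (word θ u * star (word θ v)) * corner k t
      = star (star (word θ u) * corner k t) * (star (word θ v) * corner k t) := by
        simp only [star_mul, star_star, mul_assoc]
    _ = ∑ x ∈ wordsOfDegree θ k, ∑ y ∈ wordsOfDegree θ k,
          word θ x * (star (star (word θ u) * word θ x * word θ t) *
            (star (word θ v) * word θ y * word θ t)) * star (word θ y) := by
        rw [corner, Finset.mul_sum, Finset.mul_sum, star_sum, Finset.sum_mul_sum]
        simp only [star_mul, star_star, mul_assoc]
    _ = 0 := by
        refine Finset.sum_eq_zero fun x hx => Finset.sum_eq_zero fun y hy => ?_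
        rw [mem_wordsOfDegree] at hx hy
        obtain ⟨x', rfl, hx'⟩ | hx' := star_word_mul_word_of_degree_le (x := u) (hx ▸ hu)
        · obtain ⟨y', rfl, hy'⟩ | hy' := star_word_mul_word_of_degree_le (x := v) (hy ▸ hv)
          -- `d(u) + d(x') = (k,k) = d(v) + d(y')`, so the remainders differ in degree exactly when
          -- `u` and `v` do.
          · have hxy : degree x' ≠ degree y' := fun h => huv (by
              rw [degree_mul] at hx hy
              rw [h, ← hy] at hx
              exact add_right_cancel hx)
            rw [hx', hy', ← map_mul, ← map_mul, star_word_mul_word_eq_zero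
              (ht x' y' (hx ▸ by simp) (hy ▸ by simp) hxy), mul_zero, zero_mul]
          · simp [hy']
        · simp [hx']

theorem norm_star_mul_mul_le {A : Type*} [CStarAlgebra A] {W : A} (hW : star W * W = 1) (a : A) :
    ‖star W * a * W‖ ≤ ‖a‖ := by
  -- In the zero algebra `‖1‖ = 1` fails.
  nontriviality A
  have h : ‖W‖ = 1 := by
    have := CStarRing.norm_star_mul_self (x := W)
    rw [hW, norm_one] at this
    nlinarith [norm_nonneg W]
  calc _ ≤ ‖star W‖ * ‖a‖ * ‖W‖ := norm_mul₃_le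
    _ = ‖a‖ := by rw [norm_star, h, one_mul, mul_one]

theorem eventually_star_corner_mul_mul_corner_eq {t : ℕ → TwoGraph θ}
    (ht : ∀ k, ∀ x y : TwoGraph θ, degree x ≤ (k, k) → degree y ≤ (k, k) →
      degree x ≠ degree y → ∀ a b, x * t k * a ≠ y * t k * b)
    {A : CStar θ} (hA : A ∈ wordSpan θ) :
    ∀ᶠ k in Filter.atTop, star (corner k (t k)) * A * corner k (t k) = expectation θ A := by
  simp only [← expectationL_apply]
  induction hA using Submodule.span_induction with
  | mem A hA =>
    obtain ⟨x, y, rfl⟩ := hA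
    filter_upwards [Filter.eventually_ge_atTop
      ((degree x).1 + (degree x).2 + (degree y).1 + (degree y).2)] with k hk
    have hx : degree x ≤ (k, k) := by constructor <;> simp only <;> omega
    have hy : degree y ≤ (k, k) := by constructor <;> simp only <;> omega
    rw [expectationL_apply, expectation_word_mul_star_word]
    split_ifs with h
    · exact star_corner_mul_mul_corner_of_mem _ (word_mul_star_word_mem_matrixLevel h hx)
    · exact star_corner_mul_mul_corner_eq_zero (ht k) hx hy h
  | zero => exact Filter.Eventually.of_forall fun k => by rw [map_zero, mul_zero, zero_mul]
  | add A B _ _ hA hB =>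
    filter_upwards [hA, hB] with k hA hB
    rw [mul_add, add_mul, hA, hB, map_add]
  | smul c A _ hA =>
    filter_upwards [hA] with k hA
    rw [mul_smul_comm, smul_mul_assoc, hA, map_smul]

theorem tendsto_star_corner_mul_mul_corner {t : ℕ → TwoGraph θ}
    (ht : ∀ k, ∀ x y : TwoGraph θ, degree x ≤ (k, k) → degree y ≤ (k, k) →
      degree x ≠ degree y → ∀ a b, x * t k * a ≠ y * t k * b) (A : CStar θ) :
    Filter.Tendsto (fun k => star (corner k (t k)) * A * corner k (t k)) Filter.atTop
      (nhds (expectation θ A)) := by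
  rw [Metric.tendsto_nhds]
  intro ε hε
  obtain ⟨B, hB, hAB⟩ := Metric.mem_closure_iff.1 (dense_wordSpan A) (ε / 2) (half_pos hε)
  filter_upwards [eventually_star_corner_mul_mul_corner_eq ht hB] with k hk
  rw [dist_eq_norm] at hAB ⊢
  -- The two maps agree at `B`, so only `A - B` remains; each map is contractive, whence the choice
  -- of `ε / 2`.
  calc ‖star (corner k (t k)) * A * corner k (t k) - expectation θ A‖
      = ‖star (corner k (t k)) * (A - B) * corner k (t k) - expectationL θ (A - B)‖ := by
        rw [map_sub, mul_sub, sub_mul, hk]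
        simp
    _ ≤ ‖A - B‖ + ‖A - B‖ := (norm_sub_le _ _).trans (add_le_add
        (norm_star_mul_mul_le (star_corner_mul_corner k (t k)) _) (norm_expectation_le _))
    _ < ε := by linarith

end TwoGraph

theorem mainTheorem6 {m n : ℕ} (θ : Equiv.Perm (Fin m × Fin n)) (hθ : TwoGraph.IsAperiodic θ) :
    (Set.range (TwoGraph.expectation θ) = TwoGraph.uhfCore θ ∧
      ∀ A ∈ TwoGraph.uhfCore θ, TwoGraph.expectation θ A = A) ∧
    ∃ (t : ℕ → TwoGraph θ) (W : ℕ → TwoGraph.CStar θ),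
      (∀ k, W k = ∑ x ∈ TwoGraph.wordsOfDegree θ k,
        TwoGraph.word θ x * TwoGraph.word θ (t k) * star (TwoGraph.word θ x)) ∧
      (∀ k, star (W k) * W k = 1) ∧
      ∀ A : TwoGraph.CStar θ,
        Filter.Tendsto (fun k => star (W k) * A * W k) Filter.atTop
          (nhds (TwoGraph.expectation θ A)) := by
  choose t ht using hθ.exists_separating
  exact ⟨⟨TwoGraph.range_expectation, fun A => TwoGraph.expectation_eq_self_of_mem_uhfCore⟩,
    t, fun k => TwoGraph.corner k (t k), fun _ => rfl,
    fun k => TwoGraph.star_corner_mul_corner k (t k),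
    TwoGraph.tendsto_star_corner_mul_mul_corner ht⟩
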